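/- Let $(s_m)$ be a strictly increasing sequence of positive integers with $s_m\mid s_{m+1}$, let $S=\mathrm{lcm}(s_m)$ be the corresponding (infinite) supernatural number, and let $\mathbb Z_S=\varprojlim \mathbb Z/s_m\mathbb Z$ be the odometer, a compact abelian group with normalized Haar measure $dx$ and with the element $1=(1,1,\dots)$ generating a dense cyclic subgroup. Identify the dual group of $\mathbb Z_S$ with the subgroup $\widetilde{\mathbb Z_S}=\{\chi(1):\chi \text{ a continuous character of } \mathbb Z_S\}$ of the unit circle, and for $z\in\widetilde{\mathbb Z_S}$ let $\chi_z$ be the character with $\chi_z(1)=z$. Let $\lambda:\widetilde{\mathbb Z_S}\to[1,\infty)$ be a non-archimedean length function, that is: $\lambda(z)=1$ if and only if $z=1$; $\lambda(zw)\le\max\{\lambda(z),\lambda(w)\}$ for all $z,w$; and $\{z:\lambda(z)\le r\}$ is finite for every $r\ge 1$. Assume that $\lambda$ grows fast enough: there are $\alpha,c>0$ with $\lambda(z)\ge c\,\mathrm{ord}(z)^{\alpha}$ for all $z$. For $f\in C(\mathbb Z_S)$ (complex-valued continuous functions) put $$\hat f_z=\int_{\mathbb Z_S} f(x)\,\chi_{\bar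 z}(x)\,dx,\qquad \|f\|_N=\sum_{z\in\widetilde{\mathbb Z_S}}|\hat f_z|\,\lambda(z)^N\in[0,\infty]\quad(N=0,1,2,\dots),$$ and let $C_{RD}(\mathbb Z_S)=\{f\in C(\mathbb Z_S): \|f\|_N<\infty\text{ for every }N\}$. Then $C_{RD}(\mathbb Z_S)$ is a smooth subalgebra of the C$^*$-algebra $C(\mathbb Z_S)$. That is: 1. $C_{RD}(\mathbb Z_S)$ is a dense unital $*$-subalgebra of $C(\mathbb Z_S)$; the $\|\cdot\|_N$ are submultiplicative seminorms on it, and the topology they define makes it a Fréchet $*$-algebra (Hausdorff, complete, with continuous product and involution) and is stronger than the topology of the sup norm. 2. $C_{RD}(\mathbb Z_S)$ is stable under the smooth functional calculus of self-adjoint elements: if $a\in C_{RD}(\mathbb Z_S)$ is self-adjoint and $f$ is a complex-valued smooth function on an open neighbourhood in $\mathbb R$ of the spectrum of $a$, then $f(a)\in C_{RD}(\mathbb Z_S)$. Moreover, $C_{RD}(\mathbb Z_S)$ has polynomially bounded exponentials: for every self-adjoint $a\in C_{RD}(\mathbb Z_S)$ and every $N$ there are an integer $k\ge 0$ and a constant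 $C>0$ such that $e^{ita}\in C_{RD}(\mathbb Z_S)$ and $\|e^{ita}\|_N\le C(1+|t|)^k$ for all $t\in\mathbb R$. -/

import Mathlib

noncomputable section

open MeasureTheory Filter Topology
open scoped ENNReal ContDiff

/-! ### Odometers -/

/-- A scale: a strictly increasing sequence of positive integers, each dividing the next one. The
associated supernatural number is `S = lcm (s m)`; it is infinite. -/
structure Scale where
  seq : ℕ → ℕ
  pos : ∀ m, 0 < seq m
  dvd : ∀ m, seq m ∣ seq (m + 1)
  lt : ∀ m, seq m < seq (m + 1)

instance Scale.neZero (s : Scale) (m : ℕ) : NeZero (s.seq m) := ⟨(s.pos m).ne'⟩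

/-- The inverse limit of the groups `ℤ / s_m ℤ`, as a subgroup of their product. -/
def odometerSubgroup (s : Scale) : AddSubgroup (∀ m, ZMod (s.seq m)) where
  carrier := {y | ∀ m, ZMod.castHom (s.dvd m) (ZMod (s.seq m)) (y (m + 1)) = y m}
  zero_mem' := fun m => map_zero _
  add_mem' := fun {a b} ha hb m => by
    simp only [Set.mem_ofPred_eq] at ha hb
    rw [Pi.add_apply, map_add, ha, hb, Pi.add_apply]
  neg_mem' := fun {a} ha m => by
    simp only [Set.mem_ofPred_eq] at ha
    rw [Pi.neg_apply, map_neg, ha, Pi.neg_apply]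

/-- The odometer `ℤ_S`, with the topology induced by the product of the discrete topologies. -/
abbrev Odometer (s : Scale) : Type := odometerSubgroup s

namespace Odometer

variable (s : Scale)

theorem isClosed_odometerSubgroup :
    IsClosed (odometerSubgroup s : Set (∀ m, ZMod (s.seq m))) := by
  have h : (odometerSubgroup s : Set (∀ m, ZMod (s.seq m))) =
      ⋂ m, {y | ZMod.castHom (s.dvd m) (ZMod (s.seq m)) (y (m + 1)) = y m} := by
    ext y
    simp [odometerSubgroup]
  rw [h]
  refine isClosed_iInter fun m => isClosed_eq ?_ (continuous_apply m)
  exact continuous_of_discreteTopology.comp (continuous_apply (m + 1))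

instance : CompactSpace (Odometer s) :=
  isCompact_iff_compactSpace.mp (isClosed_odometerSubgroup s).isCompact

instance : MeasurableSpace (Odometer s) := borel _

instance : BorelSpace (Odometer s) := ⟨rfl⟩

/-- The generator `1 = (1, 1, 1, …)` of the dense cyclic subgroup of the odometer. -/
def gen : Odometer s := ⟨fun _ => 1, fun _ => map_one _⟩

/-- The normalized Haar measure. -/
def haar : Measure (Odometer s) := Measure.addHaarMeasure ⊤

/-! ### The dual group -/

/-- The group of continuous characters of the odometer. Mathlib's Pontryagin dual is formulated for
multiplicative groups. -/
abbrev Characters : Type := PontryaginDual (Multiplicative (Odometer s))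

/-- The homomorphism `χ ↦ χ(1)`. -/
def evalGen : Characters s →* Circle where
  toFun χ := χ (Multiplicative.ofAdd (gen s))
  map_one' := rfl
  map_mul' _ _ := rfl

theorem val_cast_of_le (x : Odometer s) (m k : ℕ) :
    (((x.1 (m + k)).val : ℕ) : ZMod (s.seq m)) = x.1 m := by
  induction k with
  | zero => simp
  | succ k ih =>
    have h := x.2 (m + k)
    have hd : s.seq m ∣ s.seq (m + k) := by
      clear ih h
      induction k with
      | zero => exact dvd_rfl
      | succ k ih => exact ih.trans (s.dvd _)
    rw [← ih, ← h, ← Nat.add_assoc, ZMod.castHom_apply, ZMod.cast_eq_val, ZMod.val_natCast,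
      ← ZMod.natCast_mod (_ % _), Nat.mod_mod_of_dvd _ hd, ZMod.natCast_mod]

theorem evalGen_injective : Function.Injective (evalGen s) := by
  intro χ ψ h
  refine PontryaginDual.ext fun a => ?_
  obtain ⟨x, rfl⟩ := Multiplicative.ofAdd.surjective a
  have hlim : Tendsto (fun n : ℕ => Multiplicative.ofAdd ((x.1 n).val • gen s)) atTop
      (𝓝 (Multiplicative.ofAdd x)) := by
    refine (continuous_ofAdd.tendsto x).comp ?_
    rw [tendsto_subtype_rng, tendsto_pi_nhds]
    intro m
    refine tendsto_const_nhds.congr' ?_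
    filter_upwards [eventually_ge_atTop m] with n hn
    obtain ⟨k, rfl⟩ := Nat.exists_eq_add_of_le hn
    rw [← val_cast_of_le s x m k]
    simp [gen]
  have h1 := ((map_continuous χ).tendsto _).comp hlim
  have h2 := ((map_continuous ψ).tendsto _).comp hlim
  refine tendsto_nhds_unique h1 (h2.congr fun n => ?_)
  have h' : χ (Multiplicative.ofAdd (gen s)) = ψ (Multiplicative.ofAdd (gen s)) := h
  simp only [Function.comp_apply, ofAdd_nsmul, map_pow, h']

/-- The dual group of the odometer, viewed as the subgroup `{χ(1)}` of the unit circle. -/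
def dual : Subgroup Circle := (evalGen s).range

variable {s}

/-- The character `χ_z` of the odometer determined by `χ_z(1) = z`. -/
def character (z : dual s) : Characters s :=
  (MonoidHom.ofInjective (evalGen_injective s)).symm z

theorem character_gen (z : dual s) :
    character z (Multiplicative.ofAdd (gen s)) = (z : Circle) :=
  congrArg Subtype.val ((MonoidHom.ofInjective (evalGen_injective s)).apply_symm_apply z)

/-! ### Length functions -/

/-- Non-archimedean length functions on the dual of the odometer. -/
structure IsLengthFunction (l : dual s → ℝ) : Prop where
  one_le : ∀ z, 1 ≤ l z
  eq_one_iff : ∀ z, l z = 1 ↔ z = 1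
  mul_le : ∀ z w, l (z * w) ≤ max (l z) (l w)
  finite : ∀ r : ℝ, 1 ≤ r → {z | l z ≤ r}.Finite

/-- The length function grows at least like a positive power of the order. -/
def GrowsFastEnough (l : dual s → ℝ) : Prop :=
  ∃ α > (0 : ℝ), ∃ c > (0 : ℝ), ∀ z : dual s, c * (orderOf z : ℝ) ^ α ≤ l z

/-! ### Rapid decay functions -/

/-- The Fourier coefficient `∫ f(x) χ_{z⁻¹}(x) dx`; note that `z⁻¹` is the conjugate of `z`. -/
def fourierCoeff (f : C(Odometer s, ℂ)) (z : dual s) : ℂ :=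
  ∫ x, f x * (character z⁻¹ (Multiplicative.ofAdd x) : ℂ) ∂(haar s)

/-- The (possibly infinite) norm `‖f‖_N = ∑_z |f̂_z| λ(z)^N`. -/
def rdNorm (l : dual s → ℝ) (N : ℕ) (f : C(Odometer s, ℂ)) : ℝ≥0∞ :=
  ∑' z, ENNReal.ofReal (‖fourierCoeff f z‖ * l z ^ N)

/-- The space `C_RD(ℤ_S)` of rapid decay functions. -/
def rapidDecay (l : dual s → ℝ) : Set C(Odometer s, ℂ) :=
  {f | ∀ N, rdNorm l N f < ⊤}

end Odometer

/-! ### Smooth subalgebras of C*-algebras -/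

/-- `E` is a Fréchet *-algebra whose topology is given by the submultiplicative seminorms `p N`. -/
structure IsFrechetStarAlgebra (E : Type*) [Ring E] [StarRing E] [Algebra ℂ E] [UniformSpace E]
    (p : SeminormFamily ℂ E ℕ) : Prop where
  isUniformAddGroup : IsUniformAddGroup E
  withSeminorms : WithSeminorms p
  t2Space : T2Space E
  completeSpace : CompleteSpace E
  mul_le : ∀ N a b, p N (a * b) ≤ p N a * p N b
  continuousMul : ContinuousMul E
  continuousStar : ContinuousStar E

section

variable {A : Type*} [CStarAlgebra A]

/-- A dense *-subalgebra which is a Fréchet *-algebra for the seminorms `p N`, with a topology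
stronger than the norm topology. The uniform structure is the one of the additive topological group
determined by `p`; it is not the one induced by the norm of `A`. -/
structure IsFrechetSubalgebra (B : StarSubalgebra ℂ A) (p : SeminormFamily ℂ B ℕ) : Prop where
  dense : Dense (B : Set A)
  frechet : ∃ u : UniformSpace B, @IsFrechetStarAlgebra B _ _ _ u p ∧
    @Continuous B A u.toTopologicalSpace _ (Subtype.val : B → A)

/-- Stability under the smooth functional calculus of self-adjoint elements. For self-adjoint `a`
the spectrum is real, and `f(a)` is the continuous functional calculus of `z ↦ f (Re z)`. -/
def StableUnderSmoothCalculus (B : StarSubalgebra ℂ A) : Prop :=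
  ∀ a ∈ B, IsSelfAdjoint a → ∀ U : Set ℝ, IsOpen U →
    (∀ x : ℝ, (x : ℂ) ∈ spectrum ℂ a → x ∈ U) →
    ∀ f : ℝ → ℂ, ContDiffOn ℝ ∞ f U → cfc (fun z : ℂ => f z.re) a ∈ B

/-- A smooth subalgebra, with its Fréchet topology given by the seminorms `p N`. -/
structure IsSmoothSubalgebra (B : StarSubalgebra ℂ A) (p : SeminormFamily ℂ B ℕ) : Prop
    extends IsFrechetSubalgebra B p where
  stable : StableUnderSmoothCalculus B

/-- The exponentials `e^{ita}` of self-adjoint `a` belong to the subalgebra, and each of the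
seminorms of `e^{ita}` is polynomially bounded in the real number `t`. -/
def HasPolynomiallyBoundedExponentials (B : StarSubalgebra ℂ A) (p : SeminormFamily ℂ B ℕ) : Prop :=
  ∀ a ∈ B, IsSelfAdjoint a → ∀ N : ℕ, ∃ k : ℕ, ∃ C > (0 : ℝ), ∀ t : ℝ,
    ∃ h : NormedSpace.exp ((Complex.I * (t : ℂ)) • a) ∈ B,
      p N ⟨NormedSpace.exp ((Complex.I * (t : ℂ)) • a), h⟩ ≤ C * (1 + |t|) ^ k

end

end

noncomputable section

open MeasureTheory Filter Topology
open scoped ENNReal ContDiff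

/-- A sequentially complete separating sequence of submultiplicative *-invariant seminorms makes a
*-algebra into a Fréchet *-algebra, and linear maps to normed spaces that are bounded by one of the
seminorms are continuous. -/
theorem exists_isFrechetStarAlgebra {E F : Type*} [Ring E] [StarRing E] [Algebra ℂ E]
    [NormedAddCommGroup F] [NormedSpace ℂ F] (p : SeminormFamily ℂ E ℕ)
    (hmul : ∀ N a b, p N (a * b) ≤ p N a * p N b)
    (hstar : ∀ N a, p N (star a) = p N a)
    (hsep : ∀ a, p 0 a = 0 → a = 0)
    (hcomplete : ∀ u : ℕ → E,
      (∀ N, ∀ ε > 0, ∃ n₀, ∀ m ≥ n₀, ∀ n ≥ n₀, p N (u m - u n) < ε) →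
      ∃ a, ∀ N, ∀ ε > 0, ∃ n₀, ∀ n ≥ n₀, p N (u n - a) < ε)
    (φ : E →ₗ[ℂ] F) (hφ : ∀ a, ‖φ a‖ ≤ p 0 a) :
    ∃ u : UniformSpace E, IsFrechetStarAlgebra E p ∧
      @Continuous E F u.toTopologicalSpace _ φ := by
  let t : TopologicalSpace E := p.moduleFilterBasis.topology
  have hp : WithSeminorms p := ⟨rfl⟩
  have hgrp : IsTopologicalAddGroup E := hp.topologicalAddGroup
  let u : UniformSpace E := IsTopologicalAddGroup.rightUniformSpace E
  have hunif : IsUniformAddGroup E := isUniformAddGroup_of_addCommGroup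
  have hfirst : FirstCountableTopology E := hp.firstCountableTopology
  have htend : ∀ {X : Type _} (l : Filter X) (v : X → E) (a : E),
      (∀ N, Tendsto (fun x => p N (v x - a)) l (𝓝 0)) → Tendsto v l (𝓝 a) := by
    intro X l v a h
    rw [hp.tendsto_nhds]
    intro N ε hε
    exact (h N).eventually_lt_const hε
  have htend' : ∀ {X : Type _} (l : Filter X) (v : X → E) (a : E),
      Tendsto v l (𝓝 a) → ∀ N, Tendsto (fun x => p N (v x - a)) l (𝓝 0) := by
    intro X l v a h N
    have h1 : Tendsto (fun x => v x - a) l (𝓝 0) := by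
      simpa using h.sub_const a
    have h2 := ((hp.continuous_seminorm N).tendsto 0).comp h1
    rwa [map_zero] at h2
  have hT1 : T1Space E := hp.T1_of_separating fun a ha => ⟨0, fun h => ha (hsep a h)⟩
  refine ⟨u, ⟨hunif, hp, inferInstance, ?_, hmul, ⟨?_⟩, ⟨?_⟩⟩, ?_⟩
  · have : (uniformity E).IsCountablyGenerated := by
      exact IsUniformAddGroup.uniformity_countably_generated
    refine UniformSpace.complete_of_cauchySeq_tendsto fun v hv => ?_
    obtain ⟨a, ha⟩ := hcomplete v fun N ε hε => by
      have h1 : Tendsto (fun x : ℕ × ℕ => p N (v x.1 - v x.2)) atTop (𝓝 0) := by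
        have h2 : Tendsto (fun x : ℕ × ℕ => v x.2 - v x.1) atTop (𝓝 0) := by
          have := hv.tendsto_uniformity
          rw [uniformity_eq_comap_nhds_zero, tendsto_comap_iff] at this
          exact this
        have := ((hp.continuous_seminorm N).tendsto 0).comp h2
        rw [map_zero] at this
        refine this.congr fun x => ?_
        exact map_sub_rev _ _ _
      obtain ⟨⟨n₁, n₂⟩, hn⟩ := eventually_atTop.1 (h1.eventually_lt_const hε)
      exact ⟨max n₁ n₂, fun m hm n hn' => hn (m, n)
        ⟨(le_max_left _ _).trans hm, (le_max_right _ _).trans hn'⟩⟩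
    refine ⟨a, ?_⟩
    rw [hp.tendsto_nhds]
    exact fun N ε hε => eventually_atTop.2 (ha N ε hε)
  · refine continuous_iff_continuousAt.2 fun ⟨a, b⟩ => htend _ _ _ fun N => ?_
    have h1 := htend' _ _ _ (continuous_fst.tendsto (a, b)) N
    have h2 := htend' _ _ _ (continuous_snd.tendsto (a, b)) N
    have h3 : Tendsto (fun x : E × E => p N x.1) (𝓝 (a, b)) (𝓝 (p N a)) :=
      ((hp.continuous_seminorm N).comp continuous_fst).tendsto (a, b)
    have h4 := (h3.mul h2).add (h1.mul_const (p N b))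
    simp only [mul_zero, zero_mul, add_zero] at h4
    refine squeeze_zero (fun _ => apply_nonneg _ _) (fun x => ?_) h4
    calc p N (x.1 * x.2 - a * b) = p N (x.1 * (x.2 - b) + (x.1 - a) * b) := by
          congr 1; noncomm_ring
      _ ≤ _ := (map_add_le_add _ _ _).trans (add_le_add (hmul _ _ _) (hmul _ _ _))
  · refine continuous_iff_continuousAt.2 fun a => htend _ _ _ fun N => ?_
    refine (htend' _ _ _ (continuous_id.tendsto a) N).congr fun x => ?_
    rw [← star_sub, hstar]
    rfl
  · refine continuous_iff_continuousAt.2 fun a => ?_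
    refine tendsto_iff_norm_sub_tendsto_zero.2 ?_
    refine squeeze_zero (fun _ => norm_nonneg _) (fun x => ?_)
      (htend' _ _ _ (continuous_id.tendsto a) 0)
    rw [← map_sub]
    exact hφ _

namespace Odometer

variable {s : Scale}

instance : IsProbabilityMeasure (haar s) :=
  ⟨Measure.addHaarMeasure_self (K₀ := (⊤ : TopologicalSpace.PositiveCompacts (Odometer s)))⟩

instance : (haar s).IsAddHaarMeasure := by unfold haar; infer_instance

/-- The character `χ_z` as a continuous complex-valued function. -/
def charFun (z : dual s) : C(Odometer s, ℂ) where
  toFun x := (character z (Multiplicative.ofAdd x) : ℂ)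
  continuous_toFun :=
    continuous_subtype_val.comp ((map_continuous (character z)).comp continuous_ofAdd)

theorem charFun_apply (z : dual s) (x : Odometer s) :
    charFun z x = (character z (Multiplicative.ofAdd x) : ℂ) := rfl

theorem charFun_add (z : dual s) (x y : Odometer s) :
    charFun z (x + y) = charFun z x * charFun z y := by
  simp [charFun_apply, ofAdd_add]

theorem charFun_nsmul_gen (z : dual s) (n : ℕ) :
    charFun z (n • gen s) = ((z ^ n : dual s) : Circle) := by
  rw [charFun_apply, ofAdd_nsmul, map_pow, character_gen]
  rfl

theorem norm_charFun_apply (z : dual s) (x : Odometer s) : ‖charFun z x‖ = 1 :=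
  Circle.norm_coe _

theorem norm_charFun (z : dual s) : ‖charFun z‖ ≤ 1 :=
  (ContinuousMap.norm_le _ zero_le_one).2 fun x => (norm_charFun_apply z x).le

theorem character_mul (z w : dual s) : character (z * w) = character z * character w :=
  map_mul (MonoidHom.ofInjective (evalGen_injective s)).symm z w

theorem character_one : character (1 : dual s) = 1 :=
  map_one (MonoidHom.ofInjective (evalGen_injective s)).symm

theorem charFun_mul (z w : dual s) : charFun (z * w) = charFun z * charFun w := by
  ext x
  simp only [charFun_apply, character_mul, ContinuousMap.mul_apply]
  rfl

theorem charFun_one : charFun (1 : dual s) = 1 := by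
  ext x
  simp only [charFun_apply, character_one]
  rfl

theorem charFun_inv (z : dual s) : charFun z⁻¹ = star (charFun z) := by
  have h : charFun z⁻¹ * charFun z = 1 := by rw [← charFun_mul, inv_mul_cancel, charFun_one]
  ext x
  have h1 : charFun z⁻¹ x * charFun z x = 1 := DFunLike.congr_fun h x
  have h2 : star (charFun z x) * charFun z x = 1 := by
    have := Complex.conj_mul' (charFun z x)
    rw [norm_charFun_apply] at this
    simpa using this
  have h0 : charFun z x ≠ 0 := fun h => by simp [h] at h1
  exact mul_right_cancel₀ h0 (h1.trans h2.symm)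

theorem integrable_haar (f : C(Odometer s, ℂ)) : Integrable f (haar s) :=
  f.continuous.integrable_of_hasCompactSupport (HasCompactSupport.of_compactSpace f)

theorem fourierCoeff_eq (f : C(Odometer s, ℂ)) (z : dual s) :
    fourierCoeff f z = ∫ x, (f * charFun z⁻¹) x ∂(haar s) := rfl

theorem norm_integral_haar_le (f : C(Odometer s, ℂ)) : ‖∫ x, f x ∂(haar s)‖ ≤ ‖f‖ := by
  simpa using norm_integral_le_of_norm_le_const (μ := haar s) (f := f) (C := ‖f‖)
    (Eventually.of_forall f.norm_coe_le_norm)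

/-- The Fourier coefficient as a continuous linear functional. -/
def fourierCoeffCLM (z : dual s) : C(Odometer s, ℂ) →L[ℂ] ℂ :=
  LinearMap.mkContinuous
    { toFun := fun f => fourierCoeff f z
      map_add' := fun f g => by
        simp only [fourierCoeff_eq, add_mul]
        exact integral_add (integrable_haar _) (integrable_haar _)
      map_smul' := fun c f => by
        simp only [fourierCoeff_eq, smul_mul_assoc]
        exact integral_smul c _ } 1 fun f => by
      rw [one_mul]
      refine (norm_integral_haar_le (f * charFun z⁻¹)).trans ((norm_mul_le _ _).trans ?_)
      exact mul_le_of_le_one_right (norm_nonneg _) (norm_charFun _)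

theorem fourierCoeffCLM_apply (z : dual s) (f : C(Odometer s, ℂ)) :
    fourierCoeffCLM z f = fourierCoeff f z := rfl

theorem norm_fourierCoeff_le (f : C(Odometer s, ℂ)) (z : dual s) : ‖fourierCoeff f z‖ ≤ ‖f‖ := by
  refine (norm_integral_haar_le (f * charFun z⁻¹)).trans ((norm_mul_le _ _).trans ?_)
  exact mul_le_of_le_one_right (norm_nonneg _) (norm_charFun _)

theorem fourierCoeff_charFun_mul (w z : dual s) (f : C(Odometer s, ℂ)) :
    fourierCoeff (charFun w * f) z = fourierCoeff f (w⁻¹ * z) := by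
  rw [fourierCoeff_eq, fourierCoeff_eq, mul_inv_rev, inv_inv, charFun_mul]
  congr 2
  rw [mul_comm (charFun w) f, mul_assoc, mul_comm (charFun w)]

theorem fourierCoeff_star (f : C(Odometer s, ℂ)) (z : dual s) :
    fourierCoeff (star f) z = star (fourierCoeff f z⁻¹) := by
  rw [fourierCoeff_eq, fourierCoeff_eq, charFun_inv, ← star_mul, inv_inv, mul_comm]
  exact integral_conj

/-- Translation of the argument by `y` multiplies the Fourier coefficient at `z` by `χ_z(y)`. -/
theorem fourierCoeff_translate (f : C(Odometer s, ℂ)) (y : Odometer s) (z : dual s) :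
    fourierCoeff (f.comp (ContinuousMap.addRight y)) z = charFun z y * fourierCoeff f z := by
  have h : ∀ x, f (x + y) * charFun z⁻¹ x = charFun z y * (f (x + y) * charFun z⁻¹ (x + y)) := by
    intro x
    have h1 : charFun z y * charFun z⁻¹ y = 1 := by
      rw [← ContinuousMap.mul_apply, ← charFun_mul, mul_inv_cancel, charFun_one]; rfl
    rw [charFun_add]
    linear_combination -(f (x + y) * charFun z⁻¹ x) * h1
  calc fourierCoeff (f.comp (ContinuousMap.addRight y)) z
      = ∫ x, charFun z y * (f (x + y) * charFun z⁻¹ (x + y)) ∂(haar s) :=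
        integral_congr_ae (Eventually.of_forall h)
    _ = charFun z y * ∫ x, f (x + y) * charFun z⁻¹ (x + y) ∂(haar s) := integral_const_mul _ _
    _ = charFun z y * fourierCoeff f z := by
        rw [integral_add_right_eq_self (fun x => f x * charFun z⁻¹ x) y]
        rfl

open Classical in
theorem fourierCoeff_one (z : dual s) :
    fourierCoeff (1 : C(Odometer s, ℂ)) z = if z = 1 then 1 else 0 := by
  split_ifs with h
  · subst h
    rw [fourierCoeff_eq, inv_one, charFun_one]
    simp
  · have h1 := fourierCoeff_translate (1 : C(Odometer s, ℂ)) (1 • gen s) z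
    rw [ContinuousMap.one_comp, charFun_nsmul_gen, pow_one] at h1
    have h2 : ((z : Circle) : ℂ) ≠ 1 := fun h' => h (Subtype.ext (Circle.ext (by simpa using h')))
    have h3 : (((z : Circle) : ℂ) - 1) * fourierCoeff (1 : C(Odometer s, ℂ)) z = 0 := by
      linear_combination -h1
    exact (mul_eq_zero.1 h3).resolve_left (sub_ne_zero.2 h2)

open Classical in
theorem fourierCoeff_charFun (w z : dual s) :
    fourierCoeff (charFun w) z = if z = w then 1 else 0 := by
  have := fourierCoeff_charFun_mul w z 1
  rw [mul_one, fourierCoeff_one] at this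
  rw [this]
  exact if_congr (inv_mul_eq_one.trans eq_comm) rfl rfl

/-- The character of `ℤ_S` obtained from the standard character of `ℤ / s_m ℤ`. -/
def coordCharacter (s : Scale) (m : ℕ) : Characters s where
  toFun x := ZMod.toCircle (x.toAdd.1 m)
  map_one' := AddChar.map_zero_eq_one _
  map_mul' x y := AddChar.map_add_eq_mul _ _ _
  continuous_toFun := by
    refine continuous_of_discreteTopology.comp ((continuous_apply m).comp ?_)
    exact continuous_subtype_val.comp continuous_toAdd

theorem exists_charFun_eq (χ : Characters s) :
    ∃ z : dual s, ∀ x, charFun z x = (χ (Multiplicative.ofAdd x) : ℂ) := by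
  refine ⟨MonoidHom.ofInjective (evalGen_injective s) χ, fun x => ?_⟩
  exact congrArg (fun ψ : Characters s => (ψ (Multiplicative.ofAdd x) : ℂ))
    ((MonoidHom.ofInjective (evalGen_injective s)).symm_apply_apply χ)

/-- The linear span of the characters. -/
def trigPolynomials (s : Scale) : Subalgebra ℂ C(Odometer s, ℂ) :=
  Submodule.toSubalgebra (Submodule.span ℂ (Set.range (charFun (s := s))))
    (Submodule.subset_span ⟨1, charFun_one⟩) (by
      intro f g hf hg
      have h := Submodule.mul_mem_mul hf hg
      rw [Submodule.span_mul_span] at h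
      refine Submodule.span_mono ?_ h
      rintro _ ⟨_, ⟨z, rfl⟩, _, ⟨w, rfl⟩, rfl⟩
      exact ⟨z * w, charFun_mul z w⟩)

theorem star_mem_trigPolynomials (f : C(Odometer s, ℂ)) (hf : f ∈ trigPolynomials s) :
    star f ∈ trigPolynomials s := by
  change f ∈ Submodule.span ℂ _ at hf
  change star f ∈ Submodule.span ℂ _
  induction hf using Submodule.span_induction with
  | mem f hf =>
    obtain ⟨z, rfl⟩ := hf
    rw [← charFun_inv]
    exact Submodule.subset_span ⟨_, rfl⟩
  | zero => simp
  | add f g _ _ hf hg => rw [star_add]; exact add_mem hf hg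
  | smul c f _ hf => rw [star_smul]; exact Submodule.smul_mem _ _ hf

theorem dense_span_charFun :
    Dense (Submodule.span ℂ (Set.range (charFun (s := s))) : Set C(Odometer s, ℂ)) := by
  let A : StarSubalgebra ℂ C(Odometer s, ℂ) :=
    { trigPolynomials s with star_mem' := fun hf => star_mem_trigPolynomials _ hf }
  have hA : A.topologicalClosure = ⊤ := by
    refine ContinuousMap.starSubalgebra_topologicalClosure_eq_top_of_separatesPoints A ?_
    intro x y hxy
    obtain ⟨m, hm⟩ : ∃ m, x.1 m ≠ y.1 m := by
      by_contra! h
      exact hxy (Subtype.ext (funext h))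
    obtain ⟨z, hz⟩ := exists_charFun_eq (coordCharacter s m)
    refine ⟨charFun z, ⟨charFun z, Submodule.subset_span ⟨z, rfl⟩, rfl⟩, ?_⟩
    rw [hz, hz]
    intro h
    exact hm (ZMod.injective_toCircle (Circle.ext h))
  have := congrArg (fun B : StarSubalgebra ℂ C(Odometer s, ℂ) => (B : Set C(Odometer s, ℂ))) hA
  simp only [StarSubalgebra.topologicalClosure_coe, StarSubalgebra.coe_top] at this
  exact dense_iff_closure_eq.2 this

theorem eq_zero_of_fourierCoeff_eq_zero (f : C(Odometer s, ℂ)) (hf : ∀ z, fourierCoeff f z = 0) :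
    f = 0 := by
  have h0 : ∀ g : C(Odometer s, ℂ), fourierCoeff (g * f) 1 = 0 := by
    intro g
    have hc : IsClosed {g : C(Odometer s, ℂ) | fourierCoeffCLM 1 (g * f) = 0} :=
      isClosed_eq (by fun_prop) continuous_const
    refine closure_minimal ?_ hc (dense_span_charFun g)
    intro g hg
    induction hg using Submodule.span_induction with
    | mem g hg =>
      obtain ⟨z, rfl⟩ := hg
      rw [Set.mem_ofPred_eq, fourierCoeffCLM_apply, fourierCoeff_charFun_mul, hf]
    | zero => simp
    | add g g' _ _ hg hg' =>
      rw [Set.mem_ofPred_eq] at hg hg' ⊢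
      rw [add_mul, map_add, hg, hg', add_zero]
    | smul c g _ hg =>
      rw [Set.mem_ofPred_eq] at hg ⊢
      rw [smul_mul_assoc, map_smul, hg, smul_zero]
  have h1 := h0 (star f)
  rw [fourierCoeff_eq, inv_one, charFun_one, mul_one] at h1
  have h2 : ∫ x, ‖f x‖ ^ 2 ∂(haar s) = 0 := by
    have : ∀ x, (star f * f) x = ((‖f x‖ ^ 2 : ℝ) : ℂ) := fun x => by
      simpa using Complex.conj_mul' (f x)
    simp_rw [this] at h1
    rw [integral_complex_ofReal] at h1
    exact_mod_cast h1
  have hcont : Continuous fun x => ‖f x‖ ^ 2 := by fun_prop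
  have h3 : (fun x => ‖f x‖ ^ 2) =ᵐ[haar s] 0 :=
    (integral_eq_zero_iff_of_nonneg (fun x => by positivity)
      (hcont.integrable_of_hasCompactSupport (HasCompactSupport.of_compactSpace _))).1 h2
  have h4 := Measure.eq_of_ae_eq h3 hcont continuous_const
  ext x
  simpa using congrFun h4 x

theorem hasSum_fourier (f : C(Odometer s, ℂ)) (hf : Summable fun z => ‖fourierCoeff f z‖) :
    HasSum (fun z => fourierCoeff f z • charFun z) f := by
  have hs : Summable fun z => fourierCoeff f z • charFun z := by
    refine Summable.of_norm_bounded hf fun z => ?_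
    rw [norm_smul]
    exact mul_le_of_le_one_right (norm_nonneg _) (norm_charFun _)
  convert hs.hasSum
  rw [← sub_eq_zero]
  refine eq_zero_of_fourierCoeff_eq_zero _ fun z => ?_
  rw [← fourierCoeffCLM_apply, map_sub, ContinuousLinearMap.map_tsum _ hs]
  simp only [map_smul, fourierCoeffCLM_apply, fourierCoeff_charFun]
  simp

theorem hasSum_fourierCoeff_mul (f g : C(Odometer s, ℂ))
    (hf : Summable fun z => ‖fourierCoeff f z‖) (z : dual s) :
    HasSum (fun w => fourierCoeff f w * fourierCoeff g (w⁻¹ * z)) (fourierCoeff (f * g) z) := by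
  have h := ((hasSum_fourier f hf).mul_right g).mapL (fourierCoeffCLM z)
  simpa [smul_mul_assoc, fourierCoeffCLM_apply, fourierCoeff_charFun_mul] using h

end Odometer

namespace Odometer

variable {s : Scale} {l : dual s → ℝ}

theorem IsLengthFunction.map_one (hl : IsLengthFunction l) : l 1 = 1 := (hl.eq_one_iff 1).2 rfl

theorem IsLengthFunction.pos (hl : IsLengthFunction l) (z : dual s) : 0 < l z :=
  zero_lt_one.trans_le (hl.one_le z)

theorem IsLengthFunction.pow_le (hl : IsLengthFunction l) (z : dual s) (n : ℕ) :
    l (z ^ n) ≤ l z := by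
  induction n with
  | zero => rw [pow_zero, hl.map_one]; exact hl.one_le z
  | succ n ih => rw [pow_succ]; exact (hl.mul_le _ _).trans (max_le ih le_rfl)

theorem IsLengthFunction.isOfFinOrder (hl : IsLengthFunction l) (z : dual s) : IsOfFinOrder z := by
  rw [← finite_powers]
  refine (hl.finite (l z) (hl.one_le z)).subset ?_
  rintro _ ⟨n, rfl⟩
  exact hl.pow_le z n

theorem IsLengthFunction.map_inv (hl : IsLengthFunction l) (z : dual s) : l z⁻¹ = l z := by
  have key : ∀ w : dual s, l w⁻¹ ≤ l w := fun w => by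
    obtain ⟨n, hn, hw⟩ := (isOfFinOrder_iff_pow_eq_one).1 (hl.isOfFinOrder w)
    have : w⁻¹ = w ^ (n - 1) := by
      rw [inv_eq_iff_mul_eq_one, ← pow_succ', Nat.sub_add_cancel hn, hw]
    rw [this]
    exact hl.pow_le w _
  exact le_antisymm (key z) (by simpa using key z⁻¹)

/-! ### The rapid decay norms -/

theorem ofReal_norm_mul (x : ℂ) (r : ℝ) :
    ENNReal.ofReal (‖x‖ * r) = ‖x‖ₑ * ENNReal.ofReal r := by
  rw [ENNReal.ofReal_mul (norm_nonneg _), ofReal_norm]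

theorem rdNorm_eq (N : ℕ) (f : C(Odometer s, ℂ)) :
    rdNorm l N f = ∑' z, ‖fourierCoeff f z‖ₑ * ENNReal.ofReal (l z ^ N) :=
  tsum_congr fun _ => ofReal_norm_mul _ _

theorem rdNorm_add_le (N : ℕ) (f g : C(Odometer s, ℂ)) :
    rdNorm l N (f + g) ≤ rdNorm l N f + rdNorm l N g := by
  simp only [rdNorm_eq, ← fourierCoeffCLM_apply, map_add]
  rw [← ENNReal.tsum_add]
  refine ENNReal.tsum_le_tsum fun z => ?_
  rw [← add_mul]
  gcongr
  exact enorm_add_le _ _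

theorem rdNorm_smul (N : ℕ) (c : ℂ) (f : C(Odometer s, ℂ)) :
    rdNorm l N (c • f) = ‖c‖ₑ * rdNorm l N f := by
  simp only [rdNorm_eq, ← fourierCoeffCLM_apply, map_smul]
  rw [← ENNReal.tsum_mul_left]
  refine tsum_congr fun z => ?_
  rw [smul_eq_mul, enorm_mul, mul_assoc]

theorem rdNorm_star (hl : IsLengthFunction l) (N : ℕ) (f : C(Odometer s, ℂ)) :
    rdNorm l N (star f) = rdNorm l N f := by
  unfold rdNorm
  rw [← (Equiv.inv (dual s)).tsum_eq]
  refine tsum_congr fun z => ?_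
  rw [fourierCoeff_star, norm_star, Equiv.inv_apply, inv_inv, hl.map_inv]

theorem rdNorm_charFun (N : ℕ) (z : dual s) :
    rdNorm l N (charFun z) = ENNReal.ofReal (l z ^ N) := by
  rw [rdNorm_eq, tsum_eq_single z]
  · simp [fourierCoeff_charFun]
  · intro w hw
    simp [fourierCoeff_charFun, hw]

theorem summable_norm_fourierCoeff_mul (hl : IsLengthFunction l) {N : ℕ} {f : C(Odometer s, ℂ)}
    (hf : rdNorm l N f < ⊤) : Summable fun z => ‖fourierCoeff f z‖ * l z ^ N := by
  have h := ENNReal.summable_toReal hf.ne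
  refine h.congr fun z => ENNReal.toReal_ofReal ?_
  have := hl.pos z
  positivity

theorem summable_norm_fourierCoeff (hl : IsLengthFunction l) {f : C(Odometer s, ℂ)}
    (hf : rdNorm l 0 f < ⊤) : Summable fun z => ‖fourierCoeff f z‖ := by
  simpa using summable_norm_fourierCoeff_mul hl hf

theorem enorm_le_rdNorm (hl : IsLengthFunction l) (f : C(Odometer s, ℂ)) :
    ‖f‖ₑ ≤ rdNorm l 0 f := by
  rcases lt_or_ge (rdNorm l 0 f) ⊤ with h | h
  · have h1 := hasSum_fourier f (summable_norm_fourierCoeff hl h)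
    rw [rdNorm_eq]
    refine (congrArg _ h1.tsum_eq.symm).trans_le (enorm_tsum_le_tsum_enorm.trans ?_)
    refine ENNReal.tsum_le_tsum fun z => ?_
    rw [enorm_smul, pow_zero, ENNReal.ofReal_one]
    gcongr
    rw [← ofReal_norm]
    exact ENNReal.ofReal_le_one.2 (norm_charFun z)
  · exact le_top.trans h

theorem rdNorm_mul_le (hl : IsLengthFunction l) (N : ℕ) {f : C(Odometer s, ℂ)}
    (hf : rdNorm l 0 f < ⊤) (g : C(Odometer s, ℂ)) :
    rdNorm l N (f * g) ≤ rdNorm l N f * rdNorm l N g := by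
  have hle : ∀ w z : dual s,
      ENNReal.ofReal (l z ^ N) ≤ ENNReal.ofReal (l w ^ N) * ENNReal.ofReal (l (w⁻¹ * z) ^ N) := by
    intro w z
    have h1 := hl.one_le w
    have h2 := hl.one_le (w⁻¹ * z)
    rw [← ENNReal.ofReal_mul (by positivity), ← mul_pow]
    refine ENNReal.ofReal_le_ofReal (pow_le_pow_left₀ (hl.pos z).le ?_ N)
    calc l z = l (w * (w⁻¹ * z)) := by rw [mul_inv_cancel_left]
      _ ≤ max (l w) (l (w⁻¹ * z)) := hl.mul_le _ _
      _ ≤ l w * l (w⁻¹ * z) := max_le (le_mul_of_one_le_right (by linarith) h2)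
          (le_mul_of_one_le_left (by linarith) h1)
  calc rdNorm l N (f * g)
      ≤ ∑' z, ∑' w, (‖fourierCoeff f w‖ₑ * ENNReal.ofReal (l w ^ N)) *
          (‖fourierCoeff g (w⁻¹ * z)‖ₑ * ENNReal.ofReal (l (w⁻¹ * z) ^ N)) := by
        rw [rdNorm_eq]
        refine ENNReal.tsum_le_tsum fun z => ?_
        rw [← (hasSum_fourierCoeff_mul f g (summable_norm_fourierCoeff hl hf) z).tsum_eq]
        refine (mul_le_mul_left enorm_tsum_le_tsum_enorm _).trans ?_
        rw [← ENNReal.tsum_mul_right]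
        refine ENNReal.tsum_le_tsum fun w => ?_
        rw [enorm_mul, mul_mul_mul_comm]
        gcongr
        exact hle w z
    _ = rdNorm l N f * rdNorm l N g := by
        rw [ENNReal.tsum_comm, rdNorm_eq, ← ENNReal.tsum_mul_right]
        refine tsum_congr fun w => ?_
        rw [ENNReal.tsum_mul_left, rdNorm_eq]
        congr 1
        exact (Equiv.mulLeft w⁻¹).tsum_eq
          fun z => ‖fourierCoeff g z‖ₑ * ENNReal.ofReal (l z ^ N)

theorem lowerSemicontinuous_rdNorm (N : ℕ) : LowerSemicontinuous (rdNorm l N) := by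
  unfold rdNorm
  refine lowerSemicontinuous_tsum fun z => Continuous.lowerSemicontinuous ?_
  refine ENNReal.continuous_ofReal.comp ?_
  exact ((fourierCoeffCLM z).continuous.norm).mul_const _

/-! ### Counting elements of the dual -/

theorem card_le_of_pow_eq_one {n : ℕ} (hn : 0 < n) (t : Finset (dual s))
    (ht : ∀ z ∈ t, z ^ n = 1) : t.card ≤ n := by
  refine le_trans ?_ (Polynomial.card_nthRoots n (1 : ℂ))
  refine le_trans ?_ (Multiset.toFinset_card_le _)
  refine Finset.card_le_card_of_injOn (fun z : dual s => ((z : Circle) : ℂ)) (fun z hz => ?_) ?_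
  · have h : (z : Circle) ^ n = 1 := congrArg Subtype.val (ht z hz)
    have h' : ((z : Circle) : ℂ) ^ n = 1 := by rw [← Circle.coe_pow, h, Circle.coe_one]
    simpa [Polynomial.mem_nthRoots hn] using h'
  · exact fun z _ w _ h => Subtype.ext (Circle.ext h)

theorem exists_one_le_norm_one_sub_pow {u : ℂ} (hu : u ≠ 1) {d : ℕ} (hd : 0 < d)
    (hud : u ^ d = 1) : ∃ k, 1 ≤ ‖1 - u ^ k‖ := by
  by_contra! h
  have h0 : ∑ k ∈ Finset.range d, u ^ k = 0 := by
    rw [geom_sum_eq hu, hud, sub_self, zero_div]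
  have h1 : ∑ k ∈ Finset.range d, (1 - u ^ k) = d := by
    rw [Finset.sum_sub_distrib, h0]; simp
  have h2 : ‖∑ k ∈ Finset.range d, (1 - u ^ k)‖ < d := by
    refine (norm_sum_le _ _).trans_lt ?_
    calc _ < ∑ k ∈ Finset.range d, (1 : ℝ) :=
          Finset.sum_lt_sum_of_nonempty (Finset.nonempty_range_iff.2 hd.ne') fun k _ => h k
      _ = d := by simp
  rw [h1] at h2
  simp at h2

/-- A multiple of the generator is annihilated by all elements of the dual that are shorter than
`z`, but not by `z`. -/
theorem IsLengthFunction.exists_pow_separating (hl : IsLengthFunction l) {z : dual s}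
    (hz : z ≠ 1) :
    ∃ n : ℕ, (∀ w, l w < l z → w ^ n = 1) ∧ 1 ≤ ‖1 - (((z ^ n : dual s) : Circle) : ℂ)‖ := by
  have hlz : 1 < l z := lt_of_le_of_ne (hl.one_le z) fun h => hz ((hl.eq_one_iff z).1 h.symm)
  let B : Subgroup (dual s) :=
    { carrier := {w | l w < l z}
      one_mem' := by rw [Set.mem_ofPred_eq, hl.map_one]; exact hlz
      mul_mem' := fun ha hb => (hl.mul_le _ _).trans_lt (max_lt ha hb)
      inv_mem' := fun {a} ha => by rw [Set.mem_ofPred_eq, hl.map_inv]; exact ha }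
  have hfin : (B : Set (dual s)).Finite :=
    (hl.finite (l z) hlz.le).subset fun w (hw : l w < l z) => hw.le
  have : Finite B := hfin
  have hpos : 0 < Nat.card B := Nat.card_pos
  have hpow : ∀ w, l w < l z → w ^ Nat.card B = 1 := fun w hw =>
    congrArg Subtype.val (pow_card_eq_one' (x := (⟨w, hw⟩ : B)))
  have hzn : z ^ Nat.card B ≠ 1 := by
    classical
    intro h
    have hznot : z ∉ hfin.toFinset := fun h' => lt_irrefl (l z) (hfin.mem_toFinset.1 h')
    have hcard := card_le_of_pow_eq_one hpos (insert z hfin.toFinset) (by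
      intro w hw
      rcases Finset.mem_insert.1 hw with rfl | hw
      · exact h
      · exact hpow w (hfin.mem_toFinset.1 hw))
    rw [Finset.card_insert_of_notMem hznot, ← Set.ncard_eq_toFinset_card _ hfin] at hcard
    have : (B : Set (dual s)).ncard = Nat.card B := rfl
    omega
  obtain ⟨d, hd, hud⟩ := isOfFinOrder_iff_pow_eq_one.1 (hl.isOfFinOrder (z ^ Nat.card B))
  obtain ⟨k, hk⟩ := exists_one_le_norm_one_sub_pow
    (u := (((z ^ Nat.card B : dual s) : Circle) : ℂ))
    (fun h => hzn (Subtype.ext (Circle.ext h))) hd (by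
      have h : ((z ^ Nat.card B : dual s) : Circle) ^ d = 1 := congrArg Subtype.val hud
      rw [← Circle.coe_pow, h, Circle.coe_one])
  refine ⟨Nat.card B * k, fun w hw => by rw [pow_mul, hpow w hw, one_pow], ?_⟩
  rw [pow_mul]
  simpa using hk

theorem summable_inv_length_pow (hl : IsLengthFunction l) (hfast : GrowsFastEnough l) :
    ∃ K : ℕ, Summable fun z : dual s => (l z ^ K)⁻¹ := by
  classical
  obtain ⟨α, hα, c, hc, h⟩ := hfast
  obtain ⟨K, hK⟩ := exists_nat_ge (3 / α)
  have hαK : 3 ≤ α * K := by rwa [div_le_iff₀' hα] at hK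
  have hord : ∀ z : dual s, 0 < orderOf z := fun z => (hl.isOfFinOrder z).orderOf_pos
  have hbound : ∀ z : dual s, (l z ^ K)⁻¹ ≤ (c ^ K)⁻¹ * ((orderOf z : ℝ) ^ 3)⁻¹ := by
    intro z
    have h1 : (1 : ℝ) ≤ orderOf z := by exact_mod_cast hord z
    have h0 : (0 : ℝ) < orderOf z := by linarith
    rw [← mul_inv]
    refine inv_anti₀ (by positivity) ?_
    calc c ^ K * (orderOf z : ℝ) ^ 3 ≤ c ^ K * ((orderOf z : ℝ) ^ α) ^ K := by
          gcongr
          rw [← Real.rpow_natCast _ K, ← Real.rpow_mul h0.le, ← Real.rpow_natCast _ 3]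
          exact Real.rpow_le_rpow_of_exponent_le h1 (by exact_mod_cast hαK)
      _ = (c * (orderOf z : ℝ) ^ α) ^ K := (mul_pow _ _ _).symm
      _ ≤ l z ^ K := by gcongr; exact h z
  have hsum : Summable fun n : ℕ => ((n : ℝ) ^ 2)⁻¹ := Real.summable_nat_pow_inv.2 one_lt_two
  have key : Summable fun z : dual s => ((orderOf z : ℝ) ^ 3)⁻¹ := by
    refine summable_of_sum_le (c := ∑' n : ℕ, ((n : ℝ) ^ 2)⁻¹) (fun z => by positivity) fun t => ?_
    rw [Finset.sum_comp (fun n : ℕ => ((n : ℝ) ^ 3)⁻¹) (fun z : dual s => orderOf z)]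
    refine (Finset.sum_le_sum fun n hn => ?_).trans
      (hsum.sum_le_tsum (t.image fun z => orderOf z) fun n _ => by positivity)
    obtain ⟨z, hz, rfl⟩ := Finset.mem_image.1 hn
    have h0 : (0 : ℝ) < orderOf z := by exact_mod_cast hord z
    have hcard : ({w ∈ t | orderOf w = orderOf z}.card : ℝ) ≤ orderOf z := by
      refine mod_cast card_le_of_pow_eq_one (hord z) _ fun w hw => ?_
      rw [← (Finset.mem_filter.1 hw).2, pow_orderOf_eq_one]
    rw [nsmul_eq_mul]
    calc _ ≤ (orderOf z : ℝ) * ((orderOf z : ℝ) ^ 3)⁻¹ := by gcongr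
      _ = _ := by field_simp
  refine ⟨K, Summable.of_nonneg_of_le (fun z => ?_) hbound (key.mul_left _)⟩
  have := hl.pos z
  positivity

/-! ### Lipschitz functions of rapid decay functions -/

theorem norm_translate_sub_le (hl : IsLengthFunction l) {M : ℕ} {a : C(Odometer s, ℂ)}
    (h0 : rdNorm l 0 a < ⊤) (hM : rdNorm l M a < ⊤) {z : dual s} {n : ℕ}
    (hn : ∀ w, l w < l z → w ^ n = 1) (x : Odometer s) :
    ‖a (x + n • gen s) - a x‖ ≤ 2 * (∑' w, ‖fourierCoeff a w‖ * l w ^ M) * (l z ^ M)⁻¹ := by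
  have hsum := hasSum_fourier a (summable_norm_fourierCoeff hl h0)
  have h : ∀ y, HasSum (fun w => fourierCoeff a w * charFun w y) (a y) := fun y => by
    simpa using hsum.mapL (ContinuousMap.evalCLM ℂ y)
  have hb := ((summable_norm_fourierCoeff_mul hl hM).hasSum.mul_left 2).mul_right (l z ^ M)⁻¹
  rw [← ((h (x + n • gen s)).sub (h x)).tsum_eq]
  refine tsum_of_norm_bounded hb fun w => ?_
  have hz := hl.pos z
  have hw := hl.pos w
  rcases lt_or_ge (l w) (l z) with hwz | hwz
  · have : charFun w (x + n • gen s) = charFun w x := by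
      rw [charFun_add, charFun_nsmul_gen, hn w hwz]; simp
    rw [this, sub_self, norm_zero]
    positivity
  · rw [← mul_sub, norm_mul]
    have h1 : ‖charFun w (x + n • gen s) - charFun w x‖ ≤ 2 := by
      refine (norm_sub_le _ _).trans ?_
      rw [norm_charFun_apply, norm_charFun_apply]; norm_num
    have h2 : 1 ≤ l w ^ M * (l z ^ M)⁻¹ := by
      rw [← div_eq_mul_inv, one_le_div (by positivity)]
      gcongr
    calc _ ≤ ‖fourierCoeff a w‖ * 2 := by gcongr
      _ ≤ ‖fourierCoeff a w‖ * 2 * (l w ^ M * (l z ^ M)⁻¹) :=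
          le_mul_of_one_le_right (by positivity) h2
      _ = _ := by ring

theorem norm_fourierCoeff_le_of_lipschitz (hl : IsLengthFunction l) {M : ℕ}
    {a g : C(Odometer s, ℂ)} (h0 : rdNorm l 0 a < ⊤) (hM : rdNorm l M a < ⊤) {L : ℝ} (hL : 0 ≤ L)
    (hg : ∀ x y, ‖g x - g y‖ ≤ L * ‖a x - a y‖) {z : dual s} (hz : z ≠ 1) :
    ‖fourierCoeff g z‖ ≤ L * (2 * (∑' w, ‖fourierCoeff a w‖ * l w ^ M) * (l z ^ M)⁻¹) := by
  obtain ⟨n, hn, hzn⟩ := hl.exists_pow_separating hz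
  have hA : 0 ≤ ∑' w, ‖fourierCoeff a w‖ * l w ^ M :=
    tsum_nonneg fun w => by have := hl.pos w; positivity
  have hlz := hl.pos z
  calc ‖fourierCoeff g z‖ ≤ ‖1 - (((z ^ n : dual s) : Circle) : ℂ)‖ * ‖fourierCoeff g z‖ :=
        le_mul_of_one_le_left (norm_nonneg _) hzn
    _ = ‖fourierCoeff (g - g.comp (ContinuousMap.addRight (n • gen s))) z‖ := by
        rw [← fourierCoeffCLM_apply z (_ - _), map_sub, fourierCoeffCLM_apply,
          fourierCoeffCLM_apply, fourierCoeff_translate, charFun_nsmul_gen, ← norm_mul, sub_mul,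
          one_mul]
    _ ≤ ‖g - g.comp (ContinuousMap.addRight (n • gen s))‖ := norm_fourierCoeff_le _ _
    _ ≤ _ := by
        refine (ContinuousMap.norm_le _ (by positivity)).2 fun x => ?_
        rw [← norm_neg]
        simp only [ContinuousMap.sub_apply, ContinuousMap.comp_apply, ContinuousMap.coe_addRight,
          neg_sub]
        refine (hg _ _).trans ?_
        gcongr
        exact norm_translate_sub_le hl h0 hM hn x

/-- Functions that are Lipschitz with respect to a rapid decay function have rapid decay, with a
bound that is linear in the Lipschitz constant. -/
theorem exists_rdNorm_le_of_lipschitz (hl : IsLengthFunction l) (hfast : GrowsFastEnough l)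
    {a : C(Odometer s, ℂ)} (ha : a ∈ rapidDecay l) (N : ℕ) :
    ∃ C, 0 ≤ C ∧ ∀ (g : C(Odometer s, ℂ)) (L : ℝ), 0 ≤ L →
      (∀ x y, ‖g x - g y‖ ≤ L * ‖a x - a y‖) →
      rdNorm l N g ≤ ENNReal.ofReal (‖g‖ + C * L) := by
  classical
  obtain ⟨K, hK⟩ := summable_inv_length_pow hl hfast
  have hA : 0 ≤ ∑' w, ‖fourierCoeff a w‖ * l w ^ (N + K) :=
    tsum_nonneg fun w => by have := hl.pos w; positivity
  have hS : 0 ≤ ∑' z : dual s, (l z ^ K)⁻¹ :=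
    tsum_nonneg fun z => by have := hl.pos z; positivity
  set A := ∑' w, ‖fourierCoeff a w‖ * l w ^ (N + K)
  refine ⟨2 * A * ∑' z : dual s, (l z ^ K)⁻¹, by positivity, fun g L hL hg => ?_⟩
  have h1 : HasSum (fun z : dual s => (if z = 1 then ‖g‖ else 0) + 2 * A * L * (l z ^ K)⁻¹)
      (‖g‖ + 2 * A * L * ∑' z : dual s, (l z ^ K)⁻¹) :=
    (hasSum_ite_eq 1 ‖g‖).add (hK.hasSum.mul_left _)
  have hnn : ∀ z : dual s, 0 ≤ (if z = 1 then ‖g‖ else 0) + 2 * A * L * (l z ^ K)⁻¹ := by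
    intro z
    have := hl.pos z
    split_ifs <;> positivity
  calc rdNorm l N g
      ≤ ∑' z : dual s,
          ENNReal.ofReal ((if z = 1 then ‖g‖ else 0) + 2 * A * L * (l z ^ K)⁻¹) := by
        refine ENNReal.tsum_le_tsum fun z => ENNReal.ofReal_le_ofReal ?_
        have hz := hl.pos z
        split_ifs with h
        · subst h
          rw [hl.map_one, one_pow, mul_one]
          exact (norm_fourierCoeff_le g 1).trans (le_add_of_nonneg_right (by positivity))
        · rw [zero_add]
          refine (mul_le_mul_of_nonneg_right (norm_fourierCoeff_le_of_lipschitz hl (ha 0)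
            (ha (N + K)) hL hg h) (by positivity)).trans (le_of_eq ?_)
          rw [pow_add]
          field_simp
          rfl
    _ = ENNReal.ofReal (‖g‖ + 2 * A * L * ∑' z : dual s, (l z ^ K)⁻¹) := by
        rw [← ENNReal.ofReal_tsum_of_nonneg hnn h1.summable, h1.tsum_eq]
    _ = _ := by congr 1; ring

end Odometer

namespace Odometer

variable {s : Scale} {l : dual s → ℝ}

/-- The rapid decay functions form a unital *-subalgebra. -/
def rapidDecaySubalgebra (hl : IsLengthFunction l) : StarSubalgebra ℂ C(Odometer s, ℂ) where
  carrier := rapidDecay l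
  mul_mem' := fun hf hg N =>
    (rdNorm_mul_le hl N (hf 0) _).trans_lt (ENNReal.mul_lt_top (hf N) (hg N))
  add_mem' := fun hf hg N =>
    (rdNorm_add_le N _ _).trans_lt (ENNReal.add_lt_top.2 ⟨hf N, hg N⟩)
  algebraMap_mem' := fun c N => by
    rw [Algebra.algebraMap_eq_smul_one, rdNorm_smul, ← charFun_one, rdNorm_charFun]
    exact ENNReal.mul_lt_top enorm_lt_top ENNReal.ofReal_lt_top
  star_mem' := fun hf N => by
    rw [rdNorm_star hl]
    exact hf N

/-- The seminorms `‖·‖_N` on the rapid decay functions. -/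
def rdSeminorm (hl : IsLengthFunction l) : SeminormFamily ℂ (rapidDecaySubalgebra hl) ℕ :=
  fun N => Seminorm.of (fun f => (rdNorm l N (f : C(Odometer s, ℂ))).toReal)
    (fun f g => by
      rw [← ENNReal.toReal_add (f.2 N).ne (g.2 N).ne]
      exact ENNReal.toReal_mono (ENNReal.add_ne_top.2 ⟨(f.2 N).ne, (g.2 N).ne⟩)
        (rdNorm_add_le N _ _))
    (fun c f => by
      change (rdNorm l N (c • (f : C(Odometer s, ℂ)))).toReal = _
      rw [rdNorm_smul, ENNReal.toReal_mul, toReal_enorm])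

theorem rdSeminorm_apply (hl : IsLengthFunction l) (N : ℕ) (f : rapidDecaySubalgebra hl) :
    rdSeminorm hl N f = (rdNorm l N (f : C(Odometer s, ℂ))).toReal := rfl

theorem ofReal_rdSeminorm (hl : IsLengthFunction l) (N : ℕ) (f : rapidDecaySubalgebra hl) :
    ENNReal.ofReal (rdSeminorm hl N f) = rdNorm l N (f : C(Odometer s, ℂ)) :=
  ENNReal.ofReal_toReal (f.2 N).ne

theorem rdSeminorm_lt_iff (hl : IsLengthFunction l) (N : ℕ) (f : rapidDecaySubalgebra hl) {ε : ℝ}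
    (hε : 0 < ε) :
    rdSeminorm hl N f < ε ↔ rdNorm l N (f : C(Odometer s, ℂ)) < ENNReal.ofReal ε := by
  rw [← ofReal_rdSeminorm, ENNReal.ofReal_lt_ofReal_iff hε]

theorem norm_le_rdSeminorm (hl : IsLengthFunction l) (f : rapidDecaySubalgebra hl) :
    ‖(f : C(Odometer s, ℂ))‖ ≤ rdSeminorm hl 0 f := by
  rw [← toReal_enorm]
  exact ENNReal.toReal_mono (f.2 0).ne (enorm_le_rdNorm hl _)

theorem dense_rapidDecay (hl : IsLengthFunction l) :
    Dense (rapidDecaySubalgebra hl : Set C(Odometer s, ℂ)) := by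
  refine dense_span_charFun.mono ?_
  change _ ≤ (Subalgebra.toSubmodule (rapidDecaySubalgebra hl).toSubalgebra)
  rw [Submodule.span_le]
  rintro _ ⟨z, rfl⟩ N
  rw [rdNorm_charFun]
  exact ENNReal.ofReal_lt_top

theorem rdSeminorm_complete (hl : IsLengthFunction l) (u : ℕ → rapidDecaySubalgebra hl)
    (hu : ∀ N, ∀ ε > 0, ∃ n₀, ∀ m ≥ n₀, ∀ n ≥ n₀, rdSeminorm hl N (u m - u n) < ε) :
    ∃ a, ∀ N, ∀ ε > 0, ∃ n₀, ∀ n ≥ n₀, rdSeminorm hl N (u n - a) < ε := by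
  have hcau : CauchySeq fun n => (u n : C(Odometer s, ℂ)) := by
    refine Metric.cauchySeq_iff.2 fun ε hε => ?_
    obtain ⟨n₀, h⟩ := hu 0 ε hε
    refine ⟨n₀, fun m hm n hn => ?_⟩
    rw [dist_eq_norm]
    exact (norm_le_rdSeminorm hl (u m - u n)).trans_lt (h m hm n hn)
  obtain ⟨g, hg⟩ := cauchySeq_tendsto_of_complete hcau
  have key : ∀ N, ∀ ε > 0, ∃ n₀, ∀ n ≥ n₀, rdNorm l N (u n - g) ≤ ENNReal.ofReal ε := by
    intro N ε hε
    obtain ⟨n₀, h⟩ := hu N ε hε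
    refine ⟨n₀, fun n hn => ?_⟩
    have hclosed := (lowerSemicontinuous_rdNorm (l := l) N).isClosed_preimage (ENNReal.ofReal ε)
    refine hclosed.mem_of_tendsto (tendsto_const_nhds.sub hg) ?_
    filter_upwards [eventually_ge_atTop n₀] with m hm
    exact ((rdSeminorm_lt_iff hl N (u n - u m) hε).1 (h n hn m hm)).le
  have hmem : g ∈ rapidDecaySubalgebra hl := by
    intro N
    obtain ⟨n₀, h⟩ := key N 1 one_pos
    have h1 : g = (u n₀ : C(Odometer s, ℂ)) + (-1 : ℂ) • (u n₀ - g) := by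
      rw [neg_one_smul]; abel
    rw [h1]
    refine (rdNorm_add_le N _ _).trans_lt (ENNReal.add_lt_top.2 ⟨(u n₀).2 N, ?_⟩)
    rw [rdNorm_smul]
    exact ENNReal.mul_lt_top enorm_lt_top ((h n₀ le_rfl).trans_lt ENNReal.ofReal_lt_top)
  refine ⟨⟨g, hmem⟩, fun N ε hε => ?_⟩
  obtain ⟨n₀, h⟩ := key N (ε / 2) (half_pos hε)
  refine ⟨n₀, fun n hn => (rdSeminorm_lt_iff hl N _ hε).2 ((h n hn).trans_lt ?_)⟩
  exact (ENNReal.ofReal_lt_ofReal_iff hε).2 (half_lt_self hε)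

theorem isFrechetSubalgebra_rapidDecay (hl : IsLengthFunction l) :
    IsFrechetSubalgebra (rapidDecaySubalgebra hl) (rdSeminorm hl) where
  dense := dense_rapidDecay hl
  frechet := by
    refine exists_isFrechetStarAlgebra (rdSeminorm hl) ?_ ?_ ?_ (rdSeminorm_complete hl)
      (rapidDecaySubalgebra hl).subtype.toAlgHom.toLinearMap (norm_le_rdSeminorm hl)
    · intro N f g
      simp only [rdSeminorm_apply]
      rw [← ENNReal.toReal_mul]
      exact ENNReal.toReal_mono (ENNReal.mul_ne_top (f.2 N).ne (g.2 N).ne)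
        (rdNorm_mul_le hl N (f.2 0) _)
    · intro N f
      simp only [rdSeminorm_apply]
      congr 1
      exact rdNorm_star hl N _
    · intro f hf
      refine Subtype.ext (norm_le_zero_iff.1 ?_)
      exact hf ▸ norm_le_rdSeminorm hl f

theorem ofReal_re_apply {X : Type*} [TopologicalSpace X] {a : C(X, ℂ)} (ha : IsSelfAdjoint a)
    (x : X) : (((a x).re : ℝ) : ℂ) = a x :=
  Complex.conj_eq_iff_re.1 (DFunLike.congr_fun ha.star_eq x)

theorem cfc_apply_eq {X : Type*} [TopologicalSpace X] [CompactSpace X] (f : ℂ → ℂ) (a : C(X, ℂ))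
    (ha : IsStarNormal a) (hf : ContinuousOn f (spectrum ℂ a)) (x : X) :
    cfc f a x = f (a x) := by
  have h := StarAlgHomClass.map_cfc (S := ℂ) (q := IsStarNormal)
    (ContinuousMap.evalStarAlgHom ℂ ℂ x) f a hf (continuous_eval_const x) ha ⟨Commute.all _ _⟩
  simp only [ContinuousMap.evalStarAlgHom_apply] at h
  rw [h]
  exact cfc_algebraMap (A := ℂ) (a x) f

theorem stableUnderSmoothCalculus_rapidDecay (hl : IsLengthFunction l) (hfast : GrowsFastEnough l) :
    StableUnderSmoothCalculus (rapidDecaySubalgebra hl) := by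
  intro a ha hsa U hU hspec f hf N
  have hval : ∀ x, (a x).re ∈ U := fun x => by
    refine hspec _ ?_
    rw [ofReal_re_apply hsa, ContinuousMap.spectrum_eq_range]
    exact ⟨x, rfl⟩
  have hcont : ContinuousOn (fun z : ℂ => f z.re) (spectrum ℂ a) := by
    refine hf.continuousOn.comp Complex.continuous_re.continuousOn fun z hz => ?_
    rw [ContinuousMap.spectrum_eq_range] at hz
    obtain ⟨x, rfl⟩ := hz
    exact hval x
  obtain ⟨L, hL⟩ : ∃ L, LipschitzOnWith L f (Set.range fun x => (a x).re) := by
    refine LocallyLipschitzOn.exists_lipschitzOnWith_of_compact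
      (isCompact_range (by fun_prop)) ?_
    rintro _ ⟨x, rfl⟩
    have hat : ContDiffAt ℝ 1 f (a x).re :=
      (hf.contDiffAt (hU.mem_nhds (hval x))).of_le (by exact_mod_cast le_top)
    obtain ⟨K, t, ht, hK⟩ := hat.exists_lipschitzOnWith
    exact ⟨K, t, mem_nhdsWithin_of_mem_nhds ht, hK⟩
  obtain ⟨C, -, hC⟩ := exists_rdNorm_le_of_lipschitz hl hfast ha N
  refine (hC _ L L.2 fun x y => ?_).trans_lt ENNReal.ofReal_lt_top
  rw [cfc_apply_eq _ a hsa.isStarNormal hcont, cfc_apply_eq _ a hsa.isStarNormal hcont]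
  refine (hL.norm_sub_le ⟨x, rfl⟩ ⟨y, rfl⟩).trans ?_
  gcongr
  rw [← Complex.sub_re]
  exact Complex.abs_re_le_norm _

theorem exp_apply {X : Type*} [TopologicalSpace X] [CompactSpace X] (a : C(X, ℂ)) (x : X) :
    NormedSpace.exp a x = Complex.exp (a x) := by
  have h := NormedSpace.map_exp (ContinuousMap.evalStarAlgHom ℂ ℂ x)
    (continuous_eval_const x) a
  rw [Complex.exp_eq_exp_ℂ]
  exact h

theorem norm_exp_I_mul_sub_le (t u v : ℝ) :
    ‖Complex.exp (Complex.I * t * u) - Complex.exp (Complex.I * t * v)‖ ≤ |t| * |u - v| := by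
  have h : Complex.exp (Complex.I * t * u) - Complex.exp (Complex.I * t * v) =
      Complex.exp (Complex.I * ((t * v : ℝ) : ℂ)) *
        (Complex.exp (Complex.I * ((t * (u - v) : ℝ) : ℂ)) - 1) := by
    rw [mul_sub, mul_one, ← Complex.exp_add]
    push_cast
    ring_nf
  rw [h, norm_mul, mul_comm Complex.I, Complex.norm_exp_ofReal_mul_I, one_mul, ← abs_mul]
  exact Real.norm_exp_I_mul_ofReal_sub_one_le

theorem hasPolynomiallyBoundedExponentials_rapidDecay (hl : IsLengthFunction l)
    (hfast : GrowsFastEnough l) :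
    HasPolynomiallyBoundedExponentials (rapidDecaySubalgebra hl) (rdSeminorm hl) := by
  intro a ha hsa N
  have hexp : ∀ (t : ℝ) (x : Odometer s), NormedSpace.exp ((Complex.I * (t : ℂ)) • a) x =
      Complex.exp (Complex.I * t * ((a x).re : ℝ)) := fun t x => by
    rw [exp_apply, ContinuousMap.smul_apply, smul_eq_mul, ofReal_re_apply hsa]
  have hnorm : ∀ t : ℝ, ‖NormedSpace.exp ((Complex.I * (t : ℂ)) • a)‖ ≤ 1 := fun t => by
    refine (ContinuousMap.norm_le _ zero_le_one).2 fun x => ?_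
    rw [hexp, mul_assoc, ← Complex.ofReal_mul, mul_comm, Complex.norm_exp_ofReal_mul_I]
  have hlip : ∀ (t : ℝ) (x y : Odometer s),
      ‖NormedSpace.exp ((Complex.I * (t : ℂ)) • a) x -
        NormedSpace.exp ((Complex.I * (t : ℂ)) • a) y‖ ≤ |t| * ‖a x - a y‖ := fun t x y => by
    rw [hexp, hexp]
    refine (norm_exp_I_mul_sub_le t _ _).trans ?_
    gcongr
    rw [← Complex.sub_re]
    exact Complex.abs_re_le_norm _
  obtain ⟨C, hC0, hC⟩ := exists_rdNorm_le_of_lipschitz hl hfast ha N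
  refine ⟨1, 1 + C, by positivity, fun t => ⟨fun M => ?_, ?_⟩⟩
  · obtain ⟨C', -, hC'⟩ := exists_rdNorm_le_of_lipschitz hl hfast ha M
    exact (hC' _ |t| (abs_nonneg t) (hlip t)).trans_lt ENNReal.ofReal_lt_top
  · refine ENNReal.toReal_le_of_le_ofReal (by positivity)
      ((hC _ |t| (abs_nonneg t) (hlip t)).trans (ENNReal.ofReal_le_ofReal ?_))
    nlinarith [hnorm t, abs_nonneg t]

end Odometer

end

theorem mainTheorem2 (s : Scale) (l : Odometer.dual s → ℝ)
    (hl : Odometer.IsLengthFunction l) (hfast : Odometer.GrowsFastEnough l) :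
    ∃ (B : StarSubalgebra ℂ C(Odometer s, ℂ)) (p : SeminormFamily ℂ B ℕ),
      (B : Set C(Odometer s, ℂ)) = Odometer.rapidDecay l ∧
      (∀ (N : ℕ) (f : B), ENNReal.ofReal (p N f) = Odometer.rdNorm l N (f : C(Odometer s, ℂ))) ∧
      IsSmoothSubalgebra B p ∧
      HasPolynomiallyBoundedExponentials B p :=
  ⟨Odometer.rapidDecaySubalgebra hl, Odometer.rdSeminorm hl, rfl, Odometer.ofReal_rdSeminorm hl,
    ⟨Odometer.isFrechetSubalgebra_rapidDecay hl,
      Odometer.stableUnderSmoothCalculus_rapidDecay hl hfast⟩,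
    Odometer.hasPolynomiallyBoundedExponentials_rapidDecay hl hfast⟩
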